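/- \textbf{Theorem.} Let $E$ be a (real) Banach lattice, and let $E^*$ be its norm dual with the dual norm and the order $f\le g \iff f(x)\le g(x)$ for all $x\in E_+$. Say that a net $(x_\alpha)$ in $E$ is \emph{$uaw$-null} ($x_\alpha\xrightarrow{uaw}0$) if $|x_\alpha|\wedge u\to 0$ weakly for every $u\in E_+$, and that $E^*$ is \emph{order continuous} if $\|f_\alpha\|\to 0$ for every net $f_\alpha\downarrow 0$ in $E^*$. The following are equivalent: \begin{itemize} \item[(i)] $E^*$ is order continuous; \item[(ii)] for every norm bounded net $(x_\alpha)\subseteq E$, $x_\alpha\xrightarrow{uaw}0$ implies $x_\alpha\to 0$ weakly; \item[(iii)] for every norm bounded sequence $(x_n)\subseteq E$, $x_n\xrightarrow{uaw}0$ implies $x_n\to 0$ weakly. \end{itemize} -/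

import Mathlib

open Filter Topology

universe u v

namespace BanachLattice

/-- The canonical order on the norm dual of a normed lattice: `f ≤ g` iff `f x ≤ g x` for every
`x ≥ 0`. -/
instance dualPartialOrder {E : Type u} [NormedAddCommGroup E] [NormedSpace ℝ E] [Lattice E]
    [IsOrderedAddMonoid E] : PartialOrder (StrongDual ℝ E) where
  le f g := ∀ x : E, 0 ≤ x → f x ≤ g x
  le_refl _ _ _ := le_rfl
  le_trans _ _ _ hfg hgh x hx := (hfg x hx).trans (hgh x hx)
  le_antisymm f g hfg hgf := by
    have key : ∀ x : E, 0 ≤ x → f x = g x := fun x hx => le_antisymm (hfg x hx) (hgf x hx)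
    ext x
    rw [← posPart_sub_negPart x, map_sub, map_sub, key _ (posPart_nonneg x),
      key _ (negPart_nonneg x)]

theorem dual_le_iff {E : Type u} [NormedAddCommGroup E] [NormedSpace ℝ E] [Lattice E]
    [IsOrderedAddMonoid E] (f g : StrongDual ℝ E) :
    f ≤ g ↔ ∀ x : E, 0 ≤ x → f x ≤ g x := Iff.rfl

/-- The norm of `X` is order continuous: every net that decreases to `0` in the order of `X`
converges to `0` in norm. (Index sets in the universe of `X` suffice: a decreasing net may be
re-indexed by its range.) -/
def IsOrderContinuous (X : Type u) [NormedAddCommGroup X] [PartialOrder X] : Prop :=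
  ∀ (ι : Type u) [Preorder ι] [IsDirectedOrder ι] [Nonempty ι] (x : ι → X),
    Antitone x → IsGLB (Set.range x) 0 → Tendsto (fun i => ‖x i‖) atTop (𝓝 0)

/-- The net `x` converges to `y` in the weak topology of `E`. -/
def WeakTendsto {E : Type u} [NormedAddCommGroup E] [NormedSpace ℝ E]
    {ι : Type v} [Preorder ι] (x : ι → E) (y : E) : Prop :=
  Tendsto (fun i => toWeakSpace ℝ E (x i)) atTop (𝓝 (toWeakSpace ℝ E y))

/-- Unbounded absolute weak convergence: `|x i - y| ⊓ u → 0` weakly for every `u ≥ 0`. -/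
def UawTendsto {E : Type u} [NormedAddCommGroup E] [NormedSpace ℝ E] [Lattice E]
    {ι : Type v} [Preorder ι] (x : ι → E) (y : E) : Prop :=
  ∀ u : E, 0 ≤ u → WeakTendsto (fun i => |x i - y| ⊓ u) 0

end BanachLattice

namespace BanachLattice

/-! ### Inequalities in lattice-ordered groups and solid norms -/

section LatticeGroup

variable {E : Type u} [AddCommGroup E] [Lattice E] [IsOrderedAddMonoid E]

/-! All three conditions are tied to `DisjointSeqWeaklyNull`. Order continuity gives it through band
components of a functional. Condition (iii) gives it because disjoint sequences are always uaw-null.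

Conversely, a disjointification argument (`DisjointSeqWeaklyNull.dualAlmostOrderBounded`, the only
place where completeness enters) upgrades it to `DualAlmostOrderBounded`: up to `ε`, a positive `f`
sees only the part `|x| ⊓ u` of a bounded `x`, for one fixed `u`. Then `|x| ≤ |x| ⊓ u + (|x| - u)⁺`
yields both (ii) and order continuity. -/

theorem add_inf_le_inf_add_inf {x y u : E} (hx : 0 ≤ x) (hy : 0 ≤ y) (hu : 0 ≤ u) :
    (x + y) ⊓ u ≤ x ⊓ u + y ⊓ u := by
  rw [add_inf, inf_add, inf_add]
  refine le_inf (le_inf inf_le_left ?_) (le_inf ?_ ?_)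
  · exact inf_le_right.trans (le_add_of_nonneg_right hy)
  · exact inf_le_right.trans (le_add_of_nonneg_left hx)
  · exact inf_le_right.trans (le_add_of_nonneg_right hu)

theorem inf_add_eq_zero {a b c : E} (ha : 0 ≤ a) (hb : 0 ≤ b) (hc : 0 ≤ c)
    (hab : a ⊓ b = 0) (hac : a ⊓ c = 0) : a ⊓ (b + c) = 0 := by
  refine le_antisymm ?_ (le_inf ha (add_nonneg hb hc))
  have h := add_inf_le_inf_add_inf hb hc ha
  rwa [inf_comm b, inf_comm c, hab, hac, add_zero, inf_comm] at h

theorem inf_sum_eq_zero {κ : Type*} {a : E} {y : κ → E} (ha : 0 ≤ a) (hy : ∀ i, 0 ≤ y i)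
    (s : Finset κ) (h : ∀ i ∈ s, a ⊓ y i = 0) : a ⊓ ∑ i ∈ s, y i = 0 := by
  classical
  induction s using Finset.induction_on with
  | empty => simpa using ha
  | insert i s hi ih =>
    rw [Finset.sum_insert hi]
    exact inf_add_eq_zero ha (hy i) (Finset.sum_nonneg fun j _ => hy j)
      (h i (Finset.mem_insert_self i s)) (ih fun j hj => h j (Finset.mem_insert_of_mem hj))

theorem inf_nsmul_eq_zero {a b : E} (ha : 0 ≤ a) (hb : 0 ≤ b) (hab : a ⊓ b = 0) (n : ℕ) :
    a ⊓ n • b = 0 := by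
  induction n with
  | zero => simpa using ha
  | succ n ih =>
    rw [succ_nsmul]
    exact inf_add_eq_zero ha (nsmul_nonneg hb n) hb ih hab

/-- Since `a + b = a ⊓ b + a ⊔ b`, sums of disjoint positive elements are suprema. -/
theorem sum_le_of_pairwise_inf_eq_zero {κ : Type*} {y : κ → E} {u : E} (hu : 0 ≤ u)
    (hy : ∀ i, 0 ≤ y i) (hyu : ∀ i, y i ≤ u) (hd : Pairwise fun i j => y i ⊓ y j = 0)
    (s : Finset κ) : ∑ i ∈ s, y i ≤ u := by
  classical
  induction s using Finset.induction_on with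
  | empty => simpa using hu
  | insert i s hi ih =>
    rw [Finset.sum_insert hi]
    have h0 : y i ⊓ ∑ j ∈ s, y j = 0 :=
      inf_sum_eq_zero (hy i) hy s fun j hj => hd fun hij => hi (hij ▸ hj)
    have h := inf_add_sup (y i) (∑ j ∈ s, y j)
    rw [h0, zero_add] at h
    exact h ▸ sup_le (hyu i) ih

theorem le_inf_add_posPart_sub (x u : E) : x ≤ x ⊓ u + (x - u)⁺ := by
  rw [posPart_def, inf_add]
  refine le_inf (le_add_of_nonneg_right le_sup_right) ?_
  rw [← sub_le_iff_le_add']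
  exact le_sup_left

theorem posPart_le_posPart_sub_add {v z : E} (hz : 0 ≤ z) : v⁺ ≤ (v - z)⁺ + z := by
  rw [posPart_def v]
  refine sup_le ?_ (add_nonneg (posPart_nonneg _) hz)
  rw [← sub_le_iff_le_add]
  exact le_posPart _

end LatticeGroup

section NormedLattice

variable {E : Type u} [NormedAddCommGroup E] [Lattice E] [IsOrderedAddMonoid E] [HasSolidNorm E]

theorem norm_le_norm_of_nonneg_of_le {x y : E} (hx : 0 ≤ x) (hxy : x ≤ y) : ‖x‖ ≤ ‖y‖ :=
  norm_le_norm_of_abs_le_abs (by rwa [abs_of_nonneg hx, abs_of_nonneg (hx.trans hxy)])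

theorem norm_posPart_le (x : E) : ‖x⁺‖ ≤ ‖x‖ := by
  refine norm_le_norm_of_abs_le_abs ?_
  rw [abs_of_nonneg (posPart_nonneg x)]
  exact sup_le (le_abs_self x) (abs_nonneg x)

theorem norm_negPart_le (x : E) : ‖x⁻‖ ≤ ‖x‖ := by
  rw [← posPart_neg, ← norm_neg x]
  exact norm_posPart_le (-x)

end NormedLattice

/-! ### Positive functionals and their construction on the positive cone -/

variable {E : Type u} [NormedAddCommGroup E] [NormedSpace ℝ E]
  [Lattice E] [IsOrderedAddMonoid E]

theorem dual_mono {f : StrongDual ℝ E} (hf : 0 ≤ f) {x y : E} (h : x ≤ y) : f x ≤ f y := by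
  have := hf (y - x) (sub_nonneg.2 h)
  rw [map_sub] at this
  simpa using this

theorem abs_dual_apply_le {f : StrongDual ℝ E} (hf : 0 ≤ f) (x : E) : |f x| ≤ f |x| := by
  rw [abs_le]
  constructor
  · rw [neg_le, ← map_neg]
    exact dual_mono hf (neg_le_abs x)
  · exact dual_mono hf (le_abs_self x)

section SolidNorm

variable [HasSolidNorm E]

/-- A norm bounded additive function on the positive cone extends to a continuous functional. -/
theorem exists_dual_of_add_on_nonneg (φ : E → ℝ) (C : ℝ)
    (hadd : ∀ x y, 0 ≤ x → 0 ≤ y → φ (x + y) = φ x + φ y)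
    (hC : ∀ x, 0 ≤ x → |φ x| ≤ C * ‖x‖) :
    ∃ g : StrongDual ℝ E, ∀ x, 0 ≤ x → g x = φ x := by
  have h0 : φ 0 = 0 := by simpa using hadd 0 0 le_rfl le_rfl
  let G : E →+ ℝ :=
    { toFun := fun x => φ x⁺ - φ x⁻
      map_zero' := by simp
      map_add' := fun x y => by
        have e : (x + y)⁺ + (x⁻ + y⁻) = (x + y)⁻ + (x⁺ + y⁺) := by
          have h1 := posPart_sub_negPart x
          have h2 := posPart_sub_negPart y
          have h3 := posPart_sub_negPart (x + y)
          rw [← sub_eq_zero]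
          calc _ = ((x + y)⁺ - (x + y)⁻) - (x⁺ - x⁻) - (y⁺ - y⁻) := by abel
            _ = 0 := by rw [h1, h2, h3]; abel
        have e' := congrArg φ e
        rw [hadd _ _ (posPart_nonneg _) (add_nonneg (negPart_nonneg _) (negPart_nonneg _)),
          hadd _ _ (negPart_nonneg _) (add_nonneg (posPart_nonneg _) (posPart_nonneg _)),
          hadd _ _ (negPart_nonneg _) (negPart_nonneg _),
          hadd _ _ (posPart_nonneg _) (posPart_nonneg _)] at e'
        linarith }
  have hG : Continuous G := by
    refine AddMonoidHomClass.continuous_of_bound G (2 * |C|) fun x => ?_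
    have h1 := hC _ (posPart_nonneg x)
    have h2 := hC _ (negPart_nonneg x)
    have h3 : C * ‖x⁺‖ ≤ |C| * ‖x‖ :=
      mul_le_mul (le_abs_self C) (norm_posPart_le x) (norm_nonneg _) (abs_nonneg C)
    have h4 : C * ‖x⁻‖ ≤ |C| * ‖x‖ :=
      mul_le_mul (le_abs_self C) (norm_negPart_le x) (norm_nonneg _) (abs_nonneg C)
    have h5 : ‖G x‖ ≤ |φ x⁺| + |φ x⁻| := abs_sub (φ x⁺) (φ x⁻)
    linarith
  refine ⟨G.toRealLinearMap hG, fun x hx => ?_⟩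
  change φ x⁺ - φ x⁻ = φ x
  rw [posPart_of_nonneg hx, negPart_of_nonneg hx, h0, sub_zero]

/-- Every functional on a normed lattice is a difference of positive functionals. -/
theorem exists_nonneg_sub_nonneg (f : StrongDual ℝ E) :
    ∃ g h : StrongDual ℝ E, 0 ≤ g ∧ 0 ≤ h ∧ f = g - h := by
  -- Riesz–Kantorovich formula for the positive part of `f`.
  let φ : E → ℝ := fun x => sSup (f '' Set.Icc 0 x)
  have hub : ∀ x, ‖f‖ * ‖x‖ ∈ upperBounds (f '' Set.Icc 0 x) := by
    rintro x _ ⟨y, hy, rfl⟩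
    exact (le_abs_self _).trans ((f.le_opNorm y).trans
      (mul_le_mul_of_nonneg_left (norm_le_norm_of_nonneg_of_le hy.1 hy.2) (norm_nonneg _)))
  have hle : ∀ {x y : E}, 0 ≤ y → y ≤ x → f y ≤ φ x := fun h0 h1 =>
    le_csSup ⟨_, hub _⟩ ⟨_, ⟨h0, h1⟩, rfl⟩
  have hne : ∀ {x : E}, 0 ≤ x → (f '' Set.Icc 0 x).Nonempty := fun hx =>
    ⟨f 0, 0, ⟨le_rfl, hx⟩, rfl⟩
  have hnn : ∀ {x : E}, 0 ≤ x → 0 ≤ φ x := fun hx => by simpa using hle (le_refl (0 : E)) hx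
  obtain ⟨g, hg⟩ := exists_dual_of_add_on_nonneg φ ‖f‖ (fun x y hx hy => by
    apply le_antisymm
    · refine csSup_le (hne (add_nonneg hx hy)) ?_
      rintro _ ⟨z, ⟨hz0, hz⟩, rfl⟩
      -- Riesz decomposition: the summands of `z` lie in `[0, x]` and `[0, y]`.
      have e : f z = f (z ⊓ x) + f (z - z ⊓ x) := by rw [← map_add]; congr 1; abel
      rw [e]
      refine add_le_add (hle (le_inf hz0 hx) inf_le_right)
        (hle (sub_nonneg.2 inf_le_left) ?_)
      rw [sub_le_comm]
      exact le_inf (sub_le_self z hy) (sub_le_iff_le_add.2 hz)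
    · rw [← le_sub_iff_add_le]
      refine csSup_le (hne hx) ?_
      rintro _ ⟨a, ⟨ha0, ha⟩, rfl⟩
      rw [le_sub_comm]
      refine csSup_le (hne hy) ?_
      rintro _ ⟨b, ⟨hb0, hb⟩, rfl⟩
      rw [le_sub_iff_add_le, ← map_add]
      exact hle (add_nonneg hb0 ha0) ((add_le_add hb ha).trans_eq (add_comm y x)))
    (fun x hx => by
      rw [abs_of_nonneg (hnn hx)]
      exact csSup_le (hne hx) (hub x))
  refine ⟨g, g - f, fun x hx => ?_, fun x hx => ?_, by abel⟩
  · rw [hg x hx]; exact hnn hx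
  · have := hle hx (le_refl x)
    rw [← hg x hx] at this
    simpa using this

theorem weakTendsto_iff_forall_nonneg {ι : Type v} [Preorder ι] {x : ι → E} {y : E} :
    WeakTendsto x y ↔
      ∀ f : StrongDual ℝ E, 0 ≤ f → Tendsto (fun i => f (x i)) atTop (𝓝 (f y)) := by
  have key : WeakTendsto x y ↔
      ∀ f : StrongDual ℝ E, Tendsto (fun i => f (x i)) atTop (𝓝 (f y)) :=
    WeakBilin.tendsto_iff_forall_eval_tendsto _
      (fun a b h => (SeparatingDual.eq_iff_forall_dual_eq (R := ℝ)).2 fun f => DFunLike.congr_fun h f)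
  rw [key]
  refine ⟨fun h f _ => h f, fun h f => ?_⟩
  obtain ⟨g, k, hg, hk, rfl⟩ := exists_nonneg_sub_nonneg f
  simpa using (h g hg).sub (h k hk)

/-- The band component of a positive functional `f` generated by `u`. -/
theorem exists_dual_tendsto_inf_nsmul {f : StrongDual ℝ E} (hf : 0 ≤ f) {u : E} (hu : 0 ≤ u) :
    ∃ g : StrongDual ℝ E, ∀ x, 0 ≤ x → Tendsto (fun n : ℕ => f (x ⊓ n • u)) atTop (𝓝 (g x)) := by
  have hmono : ∀ x, Monotone fun n : ℕ => f (x ⊓ n • u) := fun x m n hmn =>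
    dual_mono hf (inf_le_inf_left x (nsmul_le_nsmul_left hu hmn))
  have hlim : ∀ x, Tendsto (fun n : ℕ => f (x ⊓ n • u)) atTop (𝓝 (⨆ n : ℕ, f (x ⊓ n • u))) :=
    fun x => tendsto_atTop_ciSup (hmono x) ⟨f x, by
      rintro _ ⟨n, rfl⟩
      exact dual_mono hf inf_le_left⟩
  obtain ⟨g, hg⟩ := exists_dual_of_add_on_nonneg (fun x => ⨆ n : ℕ, f (x ⊓ n • u)) ‖f‖
    (fun x y hx hy => by
      have hn : ∀ n : ℕ, 0 ≤ n • u := fun n => nsmul_nonneg hu n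
      apply le_antisymm
      · refine le_of_tendsto_of_tendsto' (hlim (x + y)) ((hlim x).add (hlim y)) fun n => ?_
        rw [← map_add]
        exact dual_mono hf (add_inf_le_inf_add_inf hx hy (hn n))
      -- Compare along doubled indices: `x ⊓ n • u + y ⊓ n • u ≤ (x + y) ⊓ (2 * n) • u`.
      · refine le_of_tendsto_of_tendsto' ((hlim x).add (hlim y))
          ((hlim (x + y)).comp (tendsto_id.const_mul_atTop' (two_pos : 0 < 2))) fun n => ?_
        rw [← map_add]
        refine dual_mono hf (le_inf (add_le_add inf_le_left inf_le_left) ?_)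
        simp only [id, two_mul, add_nsmul]
        exact add_le_add inf_le_right inf_le_right)
    (fun x hx => by
      have h0 : ∀ n : ℕ, 0 ≤ f (x ⊓ n • u) := fun n => hf _ (le_inf hx (nsmul_nonneg hu n))
      rw [abs_of_nonneg (ge_of_tendsto' (hlim x) h0)]
      refine le_of_tendsto' (hlim x) fun n => ?_
      exact (dual_mono hf inf_le_left).trans ((le_abs_self _).trans (f.le_opNorm x)))
  exact ⟨g, fun x hx => by rw [hg x hx]; exact hlim x⟩

/-- A decreasing net of positive functionals converges pointwise on the positive cone. -/
theorem exists_dual_tendsto_of_antitone {ι : Type*} [Preorder ι] [IsDirectedOrder ι] [Nonempty ι]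
    {F : ι → StrongDual ℝ E} (hF : Antitone F) (h0 : ∀ i, 0 ≤ F i) :
    ∃ h : StrongDual ℝ E, ∀ x, 0 ≤ x → Tendsto (fun i => F i x) atTop (𝓝 (h x)) := by
  have hlim : ∀ x, 0 ≤ x → Tendsto (fun i => F i x) atTop (𝓝 (⨅ i, F i x)) := fun x hx =>
    tendsto_atTop_ciInf (fun i j hij => hF hij x hx) ⟨0, by
      rintro _ ⟨i, rfl⟩
      exact h0 i x hx⟩
  obtain ⟨i₀⟩ := ‹Nonempty ι›
  have : Nonempty ι := ⟨i₀⟩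
  obtain ⟨h, hh⟩ := exists_dual_of_add_on_nonneg (fun x => ⨅ i, F i x) ‖F i₀‖
    (fun x y hx hy => by
      refine tendsto_nhds_unique (hlim _ (add_nonneg hx hy)) ?_
      simp only [map_add]
      exact (hlim x hx).add (hlim y hy))
    (fun x hx => by
      rw [abs_of_nonneg (ge_of_tendsto' (hlim x hx) fun i => h0 i x hx)]
      refine (ciInf_le ⟨0, ?_⟩ i₀).trans ((le_abs_self _).trans ((F i₀).le_opNorm x))
      rintro _ ⟨i, rfl⟩
      exact h0 i x hx)
  exact ⟨h, fun x hx => by rw [hh x hx]; exact hlim x hx⟩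

/-! ### Disjoint sequences, almost order boundedness and order continuity -/

/-- Positive functionals vanish along norm bounded positive disjoint sequences. -/
def DisjointSeqWeaklyNull (E : Type u) [NormedAddCommGroup E] [NormedSpace ℝ E] [Lattice E]
    [IsOrderedAddMonoid E] : Prop :=
  ∀ (w : ℕ → E) (M : ℝ), (∀ n, 0 ≤ w n) → (∀ n, ‖w n‖ ≤ M) →
    (Pairwise fun m n => w m ⊓ w n = 0) →
    ∀ f : StrongDual ℝ E, 0 ≤ f → Tendsto (fun n => f (w n)) atTop (𝓝 0)

/-- Positive functionals are uniformly small on the part of a ball above some order interval. -/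
def DualAlmostOrderBounded (E : Type u) [NormedAddCommGroup E] [NormedSpace ℝ E] [Lattice E]
    [IsOrderedAddMonoid E] : Prop :=
  ∀ f : StrongDual ℝ E, 0 ≤ f → ∀ M ε : ℝ, 0 < ε →
    ∃ u : E, 0 ≤ u ∧ ∀ x : E, ‖x‖ ≤ M → f (|x| - u)⁺ ≤ ε

/-- The band components `g N` of `f` generated by the partial sums of `w` increase and stay below
`f`. Order continuity makes them norm Cauchy, while `g (N + 1) - g N` takes the value `f (w N)` at
`w N`. -/
theorem disjointSeqWeaklyNull_of_isOrderContinuous (H : IsOrderContinuous (StrongDual ℝ E)) :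
    DisjointSeqWeaklyNull E := by
  intro w M hw hM hd f hf
  -- `s N` stops before `w N`, so `g N` vanishes at `w N` and `g (N + 1)` agrees with `f` there.
  let s : ℕ → E := fun N => ∑ n ∈ Finset.range N, w n
  have hs0 : ∀ N, 0 ≤ s N := fun N => Finset.sum_nonneg fun n _ => hw n
  have hsm : Monotone s := monotone_nat_of_le_succ fun N => by
    simp only [s, Finset.sum_range_succ]
    exact le_add_of_nonneg_right (hw N)
  choose g hg using fun N => exists_dual_tendsto_inf_nsmul hf (hs0 N)
  have hgm : Monotone g := fun m n hmn x hx =>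
    le_of_tendsto_of_tendsto' (hg m x hx) (hg n x hx) fun k =>
      dual_mono hf (inf_le_inf_left x (nsmul_le_nsmul_right (hsm hmn) k))
  have hgf : ∀ N, ∀ x, 0 ≤ x → g N x ≤ f x := fun N x hx =>
    le_of_tendsto' (hg N x hx) fun k => dual_mono hf inf_le_left
  have hg1 : ∀ N, g N (w N) = 0 := fun N => by
    refine tendsto_nhds_unique (hg N _ (hw N)) ?_
    have : w N ⊓ s N = 0 := inf_sum_eq_zero (hw N) hw _ fun i hi =>
      hd (Finset.mem_range.1 hi).ne'
    simp only [inf_nsmul_eq_zero (hw N) (hs0 N) this, map_zero]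
    exact tendsto_const_nhds
  have hg2 : ∀ N, g (N + 1) (w N) = f (w N) := fun N => by
    refine le_antisymm (hgf _ _ (hw N)) (ge_of_tendsto (hg (N + 1) _ (hw N)) ?_)
    filter_upwards [eventually_ge_atTop 1] with k hk
    refine dual_mono hf (le_inf le_rfl ?_)
    calc w N ≤ s (N + 1) := by
          simp only [s, Finset.sum_range_succ]
          exact le_add_of_nonneg_left (hs0 N)
      _ = 1 • s (N + 1) := (one_nsmul _).symm
      _ ≤ k • s (N + 1) := nsmul_le_nsmul_left (hs0 _) hk
  have hFa : Antitone fun N => f - g N := fun m n hmn x hx => sub_le_sub_left (hgm hmn x hx) (f x)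
  obtain ⟨h, hh⟩ := exists_dual_tendsto_of_antitone hFa fun N x hx => sub_nonneg.2 (hgf N x hx)
  -- Subtracting the pointwise limit `h` forces the infimum to be `0`; it cancels in `G N - G (N +
  -- 1)`.
  let G : ℕ → StrongDual ℝ E := fun N => f - g N - h
  have hGa : Antitone G := fun m n hmn x hx => sub_le_sub_right (hFa hmn x hx) (h x)
  have hG : Tendsto (fun i : ULift.{u} ℕ => ‖G i.down‖) atTop (𝓝 0) := by
    refine H (ULift.{u} ℕ) (fun i => G i.down) (fun i j hij => hGa hij) ⟨?_, ?_⟩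
    · rintro _ ⟨i, rfl⟩ x hx
      exact sub_nonneg.2
        (Antitone.le_of_tendsto (fun m n hmn => hFa hmn x hx) (hh x hx) i.down)
    · intro k hk x hx
      have hl : Tendsto (fun N => G N x) atTop (𝓝 0) := by
        simpa [G] using (hh x hx).sub_const (h x)
      exact ge_of_tendsto' hl fun N => hk ⟨⟨N⟩, rfl⟩ x hx
  have hG' : Tendsto (fun N => ‖G N‖) atTop (𝓝 0) := by
    have hup : Tendsto (ULift.up.{u} : ℕ → ULift.{u} ℕ) atTop atTop :=
      tendsto_atTop_atTop.2 fun b => ⟨b.down, fun a ha => ha⟩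
    exact hG.comp hup
  have hb : Tendsto (fun N => (‖G N‖ + ‖G (N + 1)‖) * M) atTop (𝓝 0) := by
    simpa using (hG'.add (hG'.comp (tendsto_add_atTop_nat 1))).mul_const M
  refine squeeze_zero (fun n => hf _ (hw n)) (fun N => ?_) hb
  have e : f (w N) = (G N - G (N + 1)) (w N) := by
    simp [G, hg1, hg2]
  rw [e]
  refine (le_abs_self _).trans (((G N - G (N + 1)).le_opNorm (w N)).trans ?_)
  exact mul_le_mul (norm_sub_le _ _) (hM N) (norm_nonneg _) (by positivity)

/-- The elements `w n ⊓ u` are disjoint and below `u`, so their finite sums are too; hence the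
values of a positive `f` on them are summable. -/
theorem uawTendsto_zero_of_pairwise_inf_eq_zero {w : ℕ → E} (hw : ∀ n, 0 ≤ w n)
    (hd : Pairwise fun m n => w m ⊓ w n = 0) : UawTendsto w 0 := by
  intro u hu
  rw [weakTendsto_iff_forall_nonneg]
  intro f hf
  have e : ∀ n, |w n - 0| = w n := fun n => by rw [sub_zero, abs_of_nonneg (hw n)]
  simp only [e, map_zero]
  have h0 : ∀ n, 0 ≤ w n ⊓ u := fun n => le_inf (hw n) hu
  refine (summable_of_sum_le (c := f u) (fun n => hf _ (h0 n)) fun s => ?_).tendsto_atTop_zero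
  rw [← map_sum]
  refine dual_mono hf (sum_le_of_pairwise_inf_eq_zero hu h0 (fun n => inf_le_right) ?_ s)
  exact fun m n hmn => le_antisymm ((inf_le_inf inf_le_left inf_le_left).trans (hd hmn).le)
    (le_inf (h0 m) (h0 n))

theorem disjointSeqWeaklyNull_of_uawTendsto
    (H : ∀ x : ℕ → E, Bornology.IsBounded (Set.range x) → UawTendsto x 0 → WeakTendsto x 0) :
    DisjointSeqWeaklyNull E := by
  intro w M hw hM hd f hf
  have hb : Bornology.IsBounded (Set.range w) :=
    isBounded_iff_forall_norm_le.2 ⟨M, by rintro _ ⟨n, rfl⟩; exact hM n⟩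
  simpa using weakTendsto_iff_forall_nonneg.1
    (H w hb (uawTendsto_zero_of_pairwise_inf_eq_zero hw hd)) f hf

theorem DualAlmostOrderBounded.weakTendsto_zero (H : DualAlmostOrderBounded E)
    {ι : Type v} [Preorder ι] {x : ι → E}
    (hb : Bornology.IsBounded (Set.range x)) (hx : UawTendsto x 0) : WeakTendsto x 0 := by
  rw [weakTendsto_iff_forall_nonneg]
  intro f hf
  obtain ⟨M, hM⟩ := isBounded_iff_forall_norm_le.1 hb
  rw [map_zero, Metric.tendsto_nhds]
  intro ε hε
  obtain ⟨u, hu, hfu⟩ := H f hf M (ε / 2) (half_pos hε)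
  have hlim := weakTendsto_iff_forall_nonneg.1 (hx u hu) f hf
  rw [map_zero] at hlim
  filter_upwards [hlim.eventually_lt_const (half_pos hε)] with i hi
  rw [sub_zero] at hi
  have h1 := dual_mono hf (le_inf_add_posPart_sub |x i| u)
  rw [map_add] at h1
  have h2 := hfu (x i) (hM _ ⟨i, rfl⟩)
  rw [Real.dist_eq, sub_zero]
  linarith [abs_dual_apply_le hf (x i)]

/-- On the unit ball, the tail `(|x| - u)⁺` is controlled uniformly by a single `F i₀ ≥ F i`, and
the rest by `F i u`, which becomes small because the pointwise limit of `F` is `≤ 0`. -/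
theorem DualAlmostOrderBounded.isOrderContinuous (H : DualAlmostOrderBounded E) :
    IsOrderContinuous (StrongDual ℝ E) := by
  intro ι _ _ _ F hF hglb
  have h0 : ∀ i, 0 ≤ F i := fun i => hglb.1 ⟨i, rfl⟩
  obtain ⟨h, hh⟩ := exists_dual_tendsto_of_antitone hF h0
  have hle : h ≤ 0 := hglb.2 <| by
    rintro _ ⟨i, rfl⟩ x hx
    exact Antitone.le_of_tendsto (fun j k hjk => hF hjk x hx) (hh x hx) i
  obtain ⟨i₀⟩ := ‹Nonempty ι›
  have : Nonempty ι := ⟨i₀⟩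
  rw [Metric.tendsto_nhds]
  intro ε hε
  obtain ⟨u, hu, hfu⟩ := H (F i₀) (h0 i₀) 1 (ε / 4) (by positivity)
  have hu0 : h u < ε / 4 := lt_of_le_of_lt (hle u hu) (by positivity)
  filter_upwards [(hh u hu).eventually_lt_const hu0, eventually_ge_atTop i₀] with i hi hi₀
  rw [Real.dist_eq, sub_zero, abs_of_nonneg (norm_nonneg _)]
  refine lt_of_le_of_lt (b := ε / 2) ?_ (half_lt_self hε)
  refine ContinuousLinearMap.opNorm_le_of_unit_norm (by positivity) fun x hx => ?_
  have h1 := dual_mono (h0 i) (le_inf_add_posPart_sub |x| u)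
  rw [map_add] at h1
  have h2 : F i (|x| ⊓ u) ≤ F i u := dual_mono (h0 i) inf_le_right
  have h3 : F i (|x| - u)⁺ ≤ F i₀ (|x| - u)⁺ := hF hi₀ _ (posPart_nonneg _)
  have h4 := hfu x hx.le
  have h5 := abs_dual_apply_le (h0 i) x
  rw [Real.norm_eq_abs]
  linarith

/-- If no `u` works, choose successive counterexamples `y n` against `4 ^ n` times the sum of the
earlier ones. A small correction makes their excesses disjoint while `f` stays bounded away from `0`
on them. -/
theorem DisjointSeqWeaklyNull.dualAlmostOrderBounded [CompleteSpace E] [IsOrderedModule ℝ E]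
    (H : DisjointSeqWeaklyNull E) : DualAlmostOrderBounded E := by
  intro f hf M ε hε
  by_contra! hcon
  have hcon' : ∀ u : E, ∃ x : E, 0 ≤ u → ‖x‖ ≤ M ∧ ε < f (|x| - u)⁺ := fun u => by
    by_cases hu : 0 ≤ u
    · obtain ⟨x, hx⟩ := hcon u hu
      exact ⟨x, fun _ => hx⟩
    · exact ⟨0, fun h => absurd h hu⟩
  choose X hX using hcon'
  let S : ℕ → E := fun n => Nat.rec 0 (fun n s => s + |X ((4 : ℝ) ^ n • s)|) n
  let y : ℕ → E := fun n => |X ((4 : ℝ) ^ n • S n)|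
  have hS : ∀ n, S (n + 1) = S n + y n := fun n => rfl
  have hy0 : ∀ n, 0 ≤ y n := fun n => abs_nonneg _
  have hSm : Monotone S := monotone_nat_of_le_succ fun n => by
    rw [hS]; exact le_add_of_nonneg_right (hy0 n)
  have hS0 : ∀ n, 0 ≤ S n := fun n => hSm (Nat.zero_le n)
  have hyS : ∀ {m n}, m < n → y m ≤ S n := fun {m n} hmn =>
    (hS m ▸ le_add_of_nonneg_left (hS0 m) : y m ≤ S (m + 1)).trans (hSm hmn)
  have hXn := fun n => hX _ (smul_nonneg (by positivity : (0 : ℝ) ≤ 4 ^ n) (hS0 n))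
  have hyM : ∀ n, ‖y n‖ ≤ M := fun n => by
    simp only [y, norm_abs_eq_norm]; exact (hXn n).1
  have hsum : Summable fun n => (1 / 2 : ℝ) ^ n • y n := by
    refine Summable.of_norm_bounded (g := fun n => (1 / 2 : ℝ) ^ n * M)
      (summable_geometric_two.mul_right M) fun n => ?_
    rw [norm_smul, norm_pow, Real.norm_of_nonneg (by norm_num : (0 : ℝ) ≤ 1 / 2)]
    exact mul_le_mul_of_nonneg_left (hyM n) (by positivity)
  let u : E := ∑' n, (1 / 2 : ℝ) ^ n • y n
  have hz0 : ∀ n, 0 ≤ (1 / 2 : ℝ) ^ n • y n := fun n => smul_nonneg (by positivity) (hy0 n)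
  have hyu : ∀ n, (1 / 2 : ℝ) ^ n • y n ≤ u := fun n => hsum.le_tsum n fun j _ => hz0 j
  have hu : 0 ≤ u := (hz0 0).trans (hyu 0)
  have hcu : ∀ n : ℕ, 0 ≤ (1 / 2 : ℝ) ^ n • u := fun n => smul_nonneg (by positivity) hu
  have h4S : ∀ n : ℕ, 0 ≤ (4 : ℝ) ^ n • S n := fun n => smul_nonneg (by positivity) (hS0 n)
  -- `S n` dominates the earlier `y m`, and `u` the later ones after scaling. The cost `(1 / 2) ^ n
  -- * f u` tends to `0`.
  let w : ℕ → E := fun n => (y n - (4 : ℝ) ^ n • S n - (1 / 2 : ℝ) ^ n • u)⁺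
  have hw0 : ∀ n, 0 ≤ w n := fun n => posPart_nonneg _
  have hwM : ∀ n, ‖w n‖ ≤ M := fun n => by
    refine (norm_le_norm_of_nonneg_of_le (hw0 n) ?_).trans (hyM n)
    exact sup_le ((sub_le_self _ (hcu n)).trans (sub_le_self _ (h4S n))) (hy0 n)
  have hdlt : ∀ m n, m < n → w m ⊓ w n = 0 := by
    intro m n hmn
    -- Disjointness comes from bounding `w n` by `a⁺` and `w m` by `a⁻`.
    let a : E := y n - (4 : ℝ) ^ n • y m
    have h1 : w n ≤ a⁺ := by
      refine posPart_mono ((sub_le_self _ (hcu n)).trans (sub_le_sub_left ?_ _))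
      exact smul_le_smul_of_nonneg_left (hyS hmn) (by positivity)
    have h2 : w m ≤ a⁻ := by
      refine sup_le ?_ (negPart_nonneg a)
      let c : ℝ := (1 / 4) ^ n
      have hc0 : 0 ≤ c := by positivity
      have hc1 : c ≤ 1 := pow_le_one₀ (by norm_num) (by norm_num)
      have hcs : c ≤ (1 / 2) ^ m * (1 / 2) ^ n := by
        have : c = (1 / 2) ^ n * (1 / 2) ^ n := by rw [← mul_pow]; norm_num [c]
        rw [this]
        exact mul_le_mul_of_nonneg_right
          (pow_le_pow_of_le_one (by norm_num) (by norm_num) hmn.le) (by positivity)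
      have h3 : c • y n ≤ (1 / 2 : ℝ) ^ m • u :=
        calc c • y n ≤ ((1 / 2) ^ m * (1 / 2) ^ n : ℝ) • y n :=
              smul_le_smul_of_nonneg_right hcs (hy0 n)
          _ = (1 / 2 : ℝ) ^ m • (1 / 2 : ℝ) ^ n • y n := mul_smul _ _ _
          _ ≤ _ := smul_le_smul_of_nonneg_left (hyu n) (by positivity)
      calc y m - (4 : ℝ) ^ m • S m - (1 / 2 : ℝ) ^ m • u
          ≤ y m - c • y n := sub_le_sub (sub_le_self _ (h4S m)) h3
        _ = c • (-a) := by
          have : c * 4 ^ n = 1 := by simp only [c]; rw [← mul_pow]; norm_num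
          simp only [a, neg_sub, smul_sub, smul_smul, this, one_smul]
        _ ≤ c • a⁻ := smul_le_smul_of_nonneg_left (neg_le_negPart a) hc0
        _ ≤ (1 : ℝ) • a⁻ := smul_le_smul_of_nonneg_right hc1 (negPart_nonneg a)
        _ = a⁻ := one_smul _ _
    refine le_antisymm ?_ (le_inf (hw0 m) (hw0 n))
    exact (inf_le_inf h2 h1).trans (by rw [inf_comm, posPart_inf_negPart_eq_zero])
  have hd : Pairwise fun m n => w m ⊓ w n = 0 := fun m n hmn => by
    rcases lt_or_gt_of_ne hmn with h | h
    · exact hdlt m n h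
    · rw [inf_comm]; exact hdlt n m h
  have hlim : Tendsto (fun n : ℕ => f (w n) + (1 / 2 : ℝ) ^ n * f u) atTop (𝓝 0) := by
    simpa using (H w M hw0 hwM hd f hf).add
      ((tendsto_pow_atTop_nhds_zero_of_lt_one (r := (1 / 2 : ℝ)) (by norm_num)
        (by norm_num)).mul_const (f u))
  refine absurd (ge_of_tendsto' hlim fun n => ?_) (not_le.2 hε)
  refine (hXn n).2.le.trans ?_
  have h := dual_mono hf (posPart_le_posPart_sub_add (v := y n - (4 : ℝ) ^ n • S n) (hcu n))
  rwa [map_add, map_smul, smul_eq_mul] at h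

end SolidNorm

end BanachLattice

/-! ### The equivalence -/

theorem mainTheorem2 {E : Type u} [NormedAddCommGroup E] [NormedSpace ℝ E] [CompleteSpace E]
    [Lattice E] [IsOrderedAddMonoid E] [IsOrderedModule ℝ E] [HasSolidNorm E] :
    List.TFAE [
      BanachLattice.IsOrderContinuous (StrongDual ℝ E),
      ∀ (ι : Type v) [Preorder ι] [IsDirectedOrder ι] [Nonempty ι] (x : ι → E),
        Bornology.IsBounded (Set.range x) →
          BanachLattice.UawTendsto x 0 → BanachLattice.WeakTendsto x 0,
      ∀ x : ℕ → E, Bornology.IsBounded (Set.range x) →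
        BanachLattice.UawTendsto x 0 → BanachLattice.WeakTendsto x 0] := by
  open BanachLattice in
  tfae_have 1 → 2 := fun H ι _ _ _ x hb hx =>
    (disjointSeqWeaklyNull_of_isOrderContinuous H).dualAlmostOrderBounded.weakTendsto_zero hb hx
  tfae_have 2 → 3 := fun H x hb hx => by
    have hdown : Tendsto (ULift.down.{v} : ULift.{v} ℕ → ℕ) atTop atTop :=
      tendsto_atTop_atTop.2 fun b => ⟨⟨b⟩, fun a ha => ha⟩
    have hup : Tendsto (ULift.up.{v} : ℕ → ULift.{v} ℕ) atTop atTop :=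
      tendsto_atTop_atTop.2 fun b => ⟨b.down, fun a ha => ha⟩
    have hr : Bornology.IsBounded (Set.range fun i : ULift.{v} ℕ => x i.down) :=
      hb.subset (by rintro _ ⟨i, rfl⟩; exact ⟨i.down, rfl⟩)
    exact (H (ULift.{v} ℕ) (fun i => x i.down) hr fun u hu => (hx u hu).comp hdown).comp hup
  tfae_have 3 → 1 := fun H =>
    (disjointSeqWeaklyNull_of_uawTendsto H).dualAlmostOrderBounded.isOrderContinuous
  tfae_finish
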